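/- \textbf{Definitions.} Let $G=(V,E)$ be a finite simple graph and let $E'\subseteq V\times V$ be obtained by choosing one orientation of each edge of $G$. The automaton $\mathcal A_G$ has alphabet $V$ and set of states $E'\cup\{id\}$. The state $id$ acts trivially on all words. A state $e=(x,y)\in E'$ acts on words over $V$ by fixing the empty word and by \[ e(xw)=y\,e(w),\qquad e(yw)=x\,w,\qquad e(zw)=z\,w\quad(z\neq x,y). \] For $n\ge 1$, the Schreier graph $\Gamma_n^G$ is the multigraph with vertex set $V^n$ that has, for every state $q$ and every word $u\in V^n$, one edge joining $u$ and $q(u)$ (so loops and parallel edges occur). The Szeged index of a finite multigraph $H$ is \[ \mathrm{Sz}(H)=\sum_{e\in E(H),\ e=\{u,v\}} n(u,v)\,n(v,u), \] where the sum runs over all edges, counted with multiplicity, and $n(u,v)$ denotes the number of vertices of $H$ that are closer to $u$ than to $v$ (so loops contribute $0$). \textbf{Theorem.} Let $G$ be a tree on $k\ge 2$ vertices and let $n\ge 1$. Then, for every choice of the orientation of the edges of $G$, \[ \begin{aligned} \mathrm{Sz}(\Gamma_n^G)={}&\frac{2(k-1)^2(2k^2-2k-1)}{k^3(2k-1)}\,2^n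 k^{2n}-\frac{4(k-1)^2}{k^2}\,n k^{2n}\\ &+\frac{4(k+1)(k-1)}{k^3}\,k^{2n}-\frac{4(k+1)(k-1)}{k(2k-1)}\,k^n\\ &+\left(\frac{4}{k^2}\,n k^{2n}-\frac{2(k^2+2)}{k^3(k-1)}\,k^{2n}+\frac{2(k+2)}{k^2(k-1)}\,k^n\right)\mathrm{Sz}(G). \end{aligned} \] -/

import Mathlib

/-- A transducer with set of states `Q` and alphabet `X`. -/
structure Transducer (Q X : Type*) where
  /-- The restriction map `λ`. -/
  restr : Q → X → Q
  /-- The output map `η`. -/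
  out : Q → X → X

namespace Transducer

variable {Q X : Type*}

/-- The action of a state on the words of length `n`:
`η(q, x w) = η(q, x) η(λ(q, x), w)` for a letter `x` and a word `w`. -/
def act (A : Transducer Q X) : (n : ℕ) → Q → (Fin n → X) → (Fin n → X)
  | 0, _, w => w
  | n + 1, q, w => Fin.cons (A.out q (w 0)) (act A n (A.restr q (w 0)) (Fin.tail w))

/-- The `n`-th Schreier graph, as a multigraph. Its vertices are the words of length `n`; for every
state `q` and every word `u` there is one edge, joining `u` with the image of `u` under `q`. -/
def schreierGraph (A : Transducer Q X) (n : ℕ) : Graph (Fin n → X) (Q × (Fin n → X)) where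
  vertexSet := Set.univ
  edgeSet := Set.univ
  IsLink a x y := s(a.2, A.act n a.1 a.2) = s(x, y)
  isLink_symm := fun _ _ => ⟨fun _ _ h => h.trans Sym2.eq_swap⟩
  eq_or_eq_of_isLink_of_isLink := by
    intro a x y v w h h'
    have := h.symm.trans h'
    rw [Sym2.eq_iff] at this
    tauto
  edge_mem_iff_exists_isLink := fun _ => ⟨fun _ => ⟨_, _, rfl⟩, fun _ => Set.mem_univ _⟩
  left_mem_of_isLink := fun _ _ _ _ => Set.mem_univ _

end Transducer

/-- `E'` is obtained from the edge set of `G` by choosing an orientation of each edge. -/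
def SimpleGraph.IsOrientation {V : Type*} (G : SimpleGraph V) (E' : Set (V × V)) : Prop :=
  (∀ x y, (x, y) ∈ E' → G.Adj x y) ∧
    ∀ x y, G.Adj x y → Xor ((x, y) ∈ E') ((y, x) ∈ E')

/-- The automaton of a graph whose set of oriented edges is `E'`. The states are the oriented edges
`some e` and the sink `none`, which is the state `id`. -/
def graphAutomaton {V : Type*} [DecidableEq V] (E' : Set (V × V)) :
    Transducer (Option E') V where
  restr
    | none, _ => none
    | some e, z => if z = e.1.1 then some e else none
  out
    | none, z => z
    | some e, z => if z = e.1.1 then e.1.2 else if z = e.1.2 then e.1.1 else z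

namespace Graph

variable {α β : Type*}

/-- `H.closer u v` is the number of vertices of `H` that are closer to `u` than to `v`. Parallel
edges and loops do not affect distances, so these are taken in the underlying simple graph. -/
noncomputable def closer (H : Graph α β) (u v : V(H)) : ℕ :=
  {w : V(H) | H.toSimpleGraph.edist w u < H.toSimpleGraph.edist w v}.ncard

/-- The product `n(u, v) * n(v, u)` for an edge `e` with ends `u` and `v`; it does not depend on
the order in which the ends are chosen, see `szegedTerm_eq`. -/
noncomputable def szegedTerm (H : Graph α β) (e : E(H)) : ℕ :=
  let h := (H.exists_isLink_of_mem_edgeSet e.2).choose_spec.choose_spec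
  H.closer ⟨_, h.left_mem⟩ ⟨_, h.right_mem⟩ * H.closer ⟨_, h.right_mem⟩ ⟨_, h.left_mem⟩

theorem szegedTerm_eq (H : Graph α β) (e : E(H)) {u v : α} (h : H.IsLink e.1 u v) :
    H.szegedTerm e = H.closer ⟨u, h.left_mem⟩ ⟨v, h.right_mem⟩ *
      H.closer ⟨v, h.right_mem⟩ ⟨u, h.left_mem⟩ := by
  have h' := (H.exists_isLink_of_mem_edgeSet e.2).choose_spec.choose_spec
  rcases h.eq_and_eq_or_eq_and_eq h' with ⟨hu, hv⟩ | ⟨hu, hv⟩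
  · simp only [szegedTerm, hu, hv]
  · simp only [szegedTerm, hu, hv]
    exact mul_comm _ _

/-- The Szeged index of a finite multigraph: the sum of `n(u, v) * n(v, u)` over its edges, where
each of several parallel edges counts. -/
noncomputable def szeged (H : Graph α β) : ℕ :=
  ∑ᶠ e : E(H), H.szegedTerm e

end Graph

/-!
Let `f = (x, y)` be an oriented edge. Every orbit of `f` on words that is not a single point is a
cycle of even length, and every word reaches this cycle through a single gate, whose position on the
cycle changes only along the cycle itself. The distance from a word to a vertex of the cycle is thus
the distance to the gate plus a distance on the cycle, and every word is strictly closer to exactly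
one end of each edge of the cycle. So the Szeged term of an edge is `s * (k ^ n - s)`, where `s` is
the number of words that the edge separates from a base word.

On the words over `x` and `y` the action of `f` is a binary odometer, hence a single cycle of length
`2 ^ n`, for which `s` is `k ^ (n - 1)` except at one pair of opposite edges. Each of the other
`k - 2` letters, appended to these words, gives a copy of this cycle, and any letter appended to the
other words gives a copy of their cycle with the same `s`. The sum of the terms of `f` therefore
satisfies a geometric recursion in `n`.
-/

section HalfCycle

variable {m : ℕ} [NeZero m] (a : ZMod (2 * m))

theorem val_add_one_eq_ite :
    (a + 1).val = if a.val + 1 = 2 * m then 0 else a.val + 1 := by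
  have ha := a.val_lt
  rw [ZMod.val_add, ZMod.val_one'' (by omega)]
  split_ifs with h
  · rw [h, Nat.mod_self]
  · exact Nat.mod_eq_of_lt (by omega)

theorem val_add_half_lt_iff : (a + m).val < m ↔ ¬ a.val < m := by
  have hm := NeZero.pos m
  have ha := a.val_lt
  rw [ZMod.val_add, ZMod.val_cast_of_lt (by omega)]
  rcases lt_or_ge a.val m with h | h
  · rw [Nat.mod_eq_of_lt (by omega)]
    omega
  · rw [Nat.mod_eq_sub_mod (by omega), Nat.mod_eq_of_lt (by omega)]
    omega

theorem natAbs_valMinAbs_lt_add_one_iff :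
    a.valMinAbs.natAbs < (a + 1).valMinAbs.natAbs ↔ a.val < m := by
  have ha := a.val_lt
  simp only [ZMod.valMinAbs_natAbs_eq_min, val_add_one_eq_ite]
  split_ifs <;> omega

theorem natAbs_valMinAbs_add_one_lt_iff :
    (a + 1).valMinAbs.natAbs < a.valMinAbs.natAbs ↔ ¬ a.val < m := by
  have ha := a.val_lt
  simp only [ZMod.valMinAbs_natAbs_eq_min, val_add_one_eq_ite]
  split_ifs <;> omega

end HalfCycle

section ActionGraph

variable {ι W : Type*}

/-- The simple graph underlying the action of generators `a i` on a set `W`: it joins every point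
to its images, loops and multiplicities being forgotten. -/
def actionGraph (a : ι → W → W) : SimpleGraph W :=
  SimpleGraph.fromRel fun v w => ∃ i, a i v = w

theorem actionGraph_adj_or_eq (a : ι → W → W) (i : ι) (w : W) :
    (actionGraph a).Adj w (a i w) ∨ w = a i w :=
  or_iff_not_imp_right.2 fun h => ⟨h, .inl ⟨i, rfl⟩⟩

theorem reachable_apply (a : ι → W → W) (i : ι) (w : W) : (actionGraph a).Reachable w (a i w) :=
  (actionGraph_adj_or_eq a i w).elim SimpleGraph.Adj.reachable fun h => h ▸ .rfl

theorem reachable_map_of_reachable {a : ι → W → W} {U : Type*} {K : SimpleGraph U} (φ : W → U)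
    (hφ : ∀ i w, K.Reachable (φ w) (φ (a i w))) {v w : W} (hvw : (actionGraph a).Reachable v w) :
    K.Reachable (φ v) (φ w) := by
  obtain ⟨p⟩ := hvw
  induction p with
  | nil => rfl
  | cons hadj p ih =>
    obtain ⟨-, ⟨i, rfl⟩ | ⟨i, rfl⟩⟩ := hadj
    · exact (hφ i _).trans ih
    · exact (hφ i _).symm.trans ih

theorem dist_iterate_le {a : ι → W → W} (hK : (actionGraph a).Connected) (i : ι) (w : W)
    (r : ℕ) :
    (actionGraph a).dist w ((a i)^[r] w) ≤ r := by
  induction r with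
  | zero => simp
  | succ r ih =>
    have htri := hK.dist_triangle (u := w) (v := (a i)^[r] w) (w := (a i)^[r + 1] w)
    have hone : (actionGraph a).dist ((a i)^[r] w) ((a i)^[r + 1] w) ≤ 1 := by
      rw [Function.iterate_succ_apply']
      rcases actionGraph_adj_or_eq a i ((a i)^[r] w) with hadj | heq
      · exact (SimpleGraph.dist_eq_one_iff_adj.2 hadj).le
      · simp [← heq]
    omega

/-- A gated cycle of the action of the generators `a`: a finite orbit `C` of the generator `a i`,
of even length `2 * m`, on which `T` is a cyclic coordinate. The value of `T` at any other point
is the coordinate of the gate of that point, that is, of the vertex of `C` through which every walk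
from the point to `C` enters `C`; so `T` changes only along the edges of the cycle itself. -/
structure IsGatedCycle (a : ι → W → W) (i : ι) {m : ℕ} (C : Set W) (T : W → ZMod (2 * m)) :
    Prop where
  mapsTo : Set.MapsTo (a i) C C
  injOn : Set.InjOn T C
  rotate : ∀ w ∈ C, T (a i w) = T w + 1
  fix : ∀ j w, j ≠ i ∨ w ∉ C → T (a j w) = T w

namespace IsGatedCycle

variable {a : ι → W → W} {i : ι} {m : ℕ} {C : Set W} {T : W → ZMod (2 * m)} {u v w g : W}

theorem eq_or_mem_of_adj (h : IsGatedCycle a i C T) (hvw : (actionGraph a).Adj v w) :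
    T v = T w ∨ v ∈ C ∧ w ∈ C ∧ (T w = T v + 1 ∨ T v = T w + 1) := by
  have hstep (j : ι) (x : W) :
      T x = T (a j x) ∨ x ∈ C ∧ a j x ∈ C ∧ T (a j x) = T x + 1 := by
    by_cases hx : j = i ∧ x ∈ C
    · obtain ⟨rfl, hx⟩ := hx
      exact .inr ⟨hx, h.mapsTo hx, h.rotate x hx⟩
    · exact .inl (h.fix j x (not_and_or.1 hx)).symm
  obtain ⟨-, ⟨j, rfl⟩ | ⟨j, rfl⟩⟩ := hvw
  · exact (hstep j v).imp_right fun ⟨hv, hw, hT⟩ => ⟨hv, hw, .inl hT⟩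
  · exact (hstep j w).imp Eq.symm fun ⟨hw, hv, hT⟩ => ⟨hv, hw, .inr hT⟩

theorem iterate_mem_and_apply_iterate (h : IsGatedCycle a i C T) (hu : u ∈ C) (r : ℕ) :
    (a i)^[r] u ∈ C ∧ T ((a i)^[r] u) = T u + r := by
  induction r with
  | zero => exact ⟨hu, by simp⟩
  | succ r ih =>
    rw [Function.iterate_succ_apply', h.rotate _ ih.1, ih.2, Nat.cast_succ, add_assoc]
    exact ⟨h.mapsTo ih.1, rfl⟩

variable [NeZero m]

theorem exists_gate (h : IsGatedCycle a i C T) (hu : u ∈ C) (w : W) : ∃ g ∈ C, T g = T w := by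
  obtain ⟨hmem, hT⟩ := h.iterate_mem_and_apply_iterate hu (T w - T u).val
  exact ⟨_, hmem, by rw [hT, ZMod.natCast_zmod_val, add_sub_cancel]⟩

theorem natAbs_sub_le_of_adj (h : IsGatedCycle a i C T) (hvw : (actionGraph a).Adj v w) :
    (T v - T w).valMinAbs.natAbs ≤ 1 := by
  have hone : (1 : ZMod (2 * m)).valMinAbs.natAbs ≤ 1 := by
    rw [ZMod.valMinAbs_natAbs_eq_min, ZMod.val_one'' (by omega)]
    exact min_le_left _ _
  rcases h.eq_or_mem_of_adj hvw with hT | ⟨-, -, hT | hT⟩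
  · simp [hT]
  · rwa [hT, sub_add_cancel_left, ZMod.natAbs_valMinAbs_neg]
  · rwa [hT, add_sub_cancel_left]

theorem le_length (h : IsGatedCycle a i C T) (hK : (actionGraph a).Connected)
    (p : (actionGraph a).Walk w v) (hv : v ∈ C) (hg : g ∈ C) (hgw : T g = T w) :
    (actionGraph a).dist w g + (T v - T w).valMinAbs.natAbs ≤ p.length := by
  induction p generalizing g with
  | nil => simp [h.injOn hg hv hgw]
  | @cons w w' v hadj p ih =>
    rw [SimpleGraph.Walk.length_cons]
    rcases h.eq_or_mem_of_adj hadj with hT | ⟨hw, hw', -⟩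
    · have htri := hK.dist_triangle (u := w) (v := w') (w := g)
      rw [SimpleGraph.dist_eq_one_iff_adj.2 hadj] at htri
      have hih := ih hv hg (hgw.trans hT)
      rw [hT]
      omega
    · have hih := ih hv hw' rfl
      have hsub := ZMod.natAbs_valMinAbs_add_le (T v - T w') (T w' - T w)
      have hone := h.natAbs_sub_le_of_adj hadj.symm
      rw [sub_add_sub_cancel] at hsub
      rw [h.injOn hg hw hgw, SimpleGraph.dist_self]
      omega

theorem dist_le_of_mem (h : IsGatedCycle a i C T) (hK : (actionGraph a).Connected) (hu : u ∈ C)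
    (hv : v ∈ C) : (actionGraph a).dist u v ≤ (T v - T u).valMinAbs.natAbs := by
  have dist_le_of_cast_eq {x y : W} (hx : x ∈ C) (hy : y ∈ C) {r : ℕ}
      (hr : (r : ZMod (2 * m)) = T y - T x) :
      (actionGraph a).dist x y ≤ r := by
    obtain ⟨hmem, hT⟩ := h.iterate_mem_and_apply_iterate hx r
    rw [hr, add_sub_cancel] at hT
    exact h.injOn hmem hy hT ▸ dist_iterate_le hK i x r
  have hcast := (T v - T u).natCast_natAbs_valMinAbs
  split_ifs at hcast
  · exact dist_le_of_cast_eq hu hv hcast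
  · rw [SimpleGraph.dist_comm]
    exact dist_le_of_cast_eq hv hu (hcast.trans (neg_sub _ _))

theorem exists_dist_eq_add (h : IsGatedCycle a i C T) (hK : (actionGraph a).Connected)
    (hu : u ∈ C) (w : W) : ∃ d : ℕ, ∀ v ∈ C,
      (actionGraph a).dist w v = d + (T v - T w).valMinAbs.natAbs := by
  obtain ⟨g, hg, hgw⟩ := h.exists_gate hu w
  refine ⟨(actionGraph a).dist w g, fun v hv => le_antisymm ?_ ?_⟩
  · rw [← hgw]
    exact hK.dist_triangle.trans (Nat.add_le_add_left (h.dist_le_of_mem hK hg hv) _)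
  · obtain ⟨p, hp⟩ := hK.exists_walk_length_eq_dist w v
    exact hp ▸ h.le_length hK p hv hg hgw

theorem edist_lt_iff (h : IsGatedCycle a i C T) (hK : (actionGraph a).Connected) (hu : u ∈ C)
    (w : W) : (actionGraph a).edist w u < (actionGraph a).edist w (a i u) ↔
      (T u - T w).val < m := by
  obtain ⟨d, hd⟩ := h.exists_dist_eq_add hK hu w
  rw [← (hK w _).coe_dist_eq_edist, ← (hK w _).coe_dist_eq_edist, Nat.cast_lt, hd u hu,
    hd _ (h.mapsTo hu), h.rotate u hu, add_sub_right_comm, Nat.add_lt_add_iff_left,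
    natAbs_valMinAbs_lt_add_one_iff]

theorem edist_apply_lt_iff (h : IsGatedCycle a i C T) (hK : (actionGraph a).Connected) (hu : u ∈ C)
    (w : W) : (actionGraph a).edist w (a i u) < (actionGraph a).edist w u ↔
      ¬ (T u - T w).val < m := by
  obtain ⟨d, hd⟩ := h.exists_dist_eq_add hK hu w
  rw [← (hK w _).coe_dist_eq_edist, ← (hK w _).coe_dist_eq_edist, Nat.cast_lt, hd u hu,
    hd _ (h.mapsTo hu), h.rotate u hu, add_sub_right_comm, Nat.add_lt_add_iff_left,
    natAbs_valMinAbs_add_one_lt_iff]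

end IsGatedCycle

end ActionGraph

section Offcut

open scoped Graph

variable {W : Type*}

theorem edist_map_le {U : Type*} {H : SimpleGraph U} {K : SimpleGraph W} (φ : H →g K) (u v : U) :
    K.edist (φ u) (φ v) ≤ H.edist u v :=
  le_iInf fun p => (SimpleGraph.edist_le (p.map φ)).trans_eq (by rw [SimpleGraph.Walk.length_map])

theorem edist_map_iso {U : Type*} {H : SimpleGraph U} {K : SimpleGraph W} (φ : H ≃g K) (u v : U) :
    K.edist (φ u) (φ v) = H.edist u v :=
  (edist_map_le φ.toHom u v).antisymm <| by
    simpa using! edist_map_le φ.symm.toHom (φ u) (φ v)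

theorem closer_eq_ncard {α β : Type*} {H : Graph α β} {K : SimpleGraph W}
    (φ : H.toSimpleGraph ≃g K) (u v : V(H)) :
    H.closer u v = {w | K.edist w (φ u) < K.edist w (φ v)}.ncard := by
  rw [← Set.ncard_preimage_of_injective_subset_range φ.injective
    (by simp only [φ.surjective.range_eq, Set.subset_univ])]
  simp only [Graph.closer, Set.preimage_ofPred_eq, edist_map_iso]

/-- The number of vertices which the edge from `u` to `v` separates from the base point `o`. -/
noncomputable def offcut (K : SimpleGraph W) (o u v : W) : ℕ :=
  {w | ¬ (K.edist w u < K.edist w v ↔ K.edist o u < K.edist o v)}.ncard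

theorem offcut_self (K : SimpleGraph W) (o u : W) : offcut K o u u = 0 := by
  simp [offcut]

theorem offcut_le [Finite W] (K : SimpleGraph W) (o u v : W) : offcut K o u v ≤ Nat.card W :=
  Set.ncard_le_card _

theorem closer_mul_closer_eq [Finite W] {α β : Type*} {H : Graph α β} {K : SimpleGraph W}
    (φ : H.toSimpleGraph ≃g K) (o : W) {u v : V(H)}
    (huv : φ u = φ v ∨ ∀ w, K.edist w (φ v) < K.edist w (φ u) ↔
      ¬ K.edist w (φ u) < K.edist w (φ v)) :
    H.closer u v * H.closer v u =
      offcut K o (φ u) (φ v) * (Nat.card W - offcut K o (φ u) (φ v)) := by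
  rw [closer_eq_ncard φ, closer_eq_ncard φ]
  rcases huv with heq | huv
  · simp [heq, offcut_self]
  simp only [offcut, huv]
  set A := {w | K.edist w (φ u) < K.edist w (φ v)}
  change A.ncard * Aᶜ.ncard = _
  have hcard := A.ncard_add_ncard_compl
  by_cases ho : K.edist o (φ u) < K.edist o (φ v)
  · simp only [ho, iff_true]
    change _ = Aᶜ.ncard * (_ - Aᶜ.ncard)
    rw [← hcard, Nat.add_sub_cancel, mul_comm]
  · simp only [ho, iff_false, not_not]
    change _ = A.ncard * (_ - A.ncard)
    rw [← hcard, Nat.add_sub_cancel_left]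

end Offcut

section SzegedTerm

open scoped Graph

variable {ι W α β : Type*} {a : ι → W → W} {i : ι} {H : Graph α β}

theorem IsGatedCycle.offcut_eq {m : ℕ} [NeZero m] {C : Set W} {T : W → ZMod (2 * m)} {u : W}
    (h : IsGatedCycle a i C T) (hK : (actionGraph a).Connected) (hu : u ∈ C) (o : W) :
    offcut (actionGraph a) o u (a i u) =
      {w | ¬ ((T u - T w).val < m ↔ (T u - T o).val < m)}.ncard := by
  simp only [offcut, h.edist_lt_iff hK hu]

theorem szegedTerm_eq_offcut [Finite W] (φ : H.toSimpleGraph ≃g actionGraph a)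
    (hK : (actionGraph a).Connected) (o : W) {e : E(H)} {u v : V(H)} (huv : H.IsLink e.1 u v)
    (hv : φ v = a i (φ u))
    (h : a i (φ u) = φ u ∨ ∃ (m : ℕ) (_ : NeZero m) (C : Set W) (T : W → ZMod (2 * m)),
      IsGatedCycle a i C T ∧ φ u ∈ C) :
    H.szegedTerm e = offcut (actionGraph a) o (φ u) (a i (φ u)) *
      (Nat.card W - offcut (actionGraph a) o (φ u) (a i (φ u))) := by
  rw [H.szegedTerm_eq e huv, ← hv]
  refine closer_mul_closer_eq φ o ?_
  rw [hv]
  exact h.imp Eq.symm fun ⟨_, _, _, _, hC, hu⟩ w => by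
    rw [hC.edist_lt_iff hK hu, hC.edist_apply_lt_iff hK hu]

theorem szegedTerm_eq_zero_of_isLink_self {e : E(H)} {u : α}
    (h : H.IsLink e.1 u u) : H.szegedTerm e = 0 := by
  simp [H.szegedTerm_eq e h, Graph.closer]

end SzegedTerm

section Tree

open scoped Graph

variable {V : Type*} {G : SimpleGraph V} {E' : Set (V × V)}

/-- The set `S` of letters is the side of the first end of the oriented edge `f` when `f` is
removed from the graph. -/
structure IsSide (f : E') (S : Finset V) : Prop where
  left : f.1.1 ∈ S
  right : f.1.2 ∉ S
  mem_iff_mem : ∀ g : E', g ≠ f → (g.1.1 ∈ S ↔ g.1.2 ∈ S)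

theorem IsSide.ne {f : E'} {S : Finset V} (hS : IsSide f S) : f.1.1 ≠ f.1.2 :=
  fun h => hS.right (h ▸ hS.left)

theorem IsSide.two_le_card [Fintype V] {f : E'} {S : Finset V} (hS : IsSide f S) :
    (2 : ℚ) ≤ Fintype.card V := by
  have : Nontrivial V := ⟨_, _, hS.ne⟩
  exact_mod_cast Fintype.one_lt_card (α := V)

theorem bijective_edge_of_isOrientation (hE' : G.IsOrientation E') : Function.Bijective
    fun f : E' => (⟨s(f.1.1, f.1.2), hE'.1 _ _ f.2⟩ : E(Graph.ofSimpleGraph G)) := by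
  constructor
  · rintro ⟨⟨x, y⟩, hf⟩ ⟨⟨z, t⟩, hg⟩ h
    rcases Sym2.eq_iff.1 (congrArg Subtype.val h) with ⟨rfl, rfl⟩ | ⟨rfl, rfl⟩
    · rfl
    · exact ((hE'.2 _ _ (hE'.1 _ _ hf)).elim (·.2 hg) (·.2 hf)).elim
  · rintro ⟨e, he⟩
    induction e with
    | h x y =>
      rcases hE'.2 x y he with h | h
      · exact ⟨⟨(x, y), h.1⟩, rfl⟩
      · exact ⟨⟨(y, x), h.1⟩, Subtype.ext Sym2.eq_swap⟩

theorem card_add_one_of_isOrientation [Fintype V] [Fintype E'] (hG : G.IsTree)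
    (hE' : G.IsOrientation E') : Fintype.card E' + 1 = Fintype.card V := by
  classical
  rw [← hG.card_edgeFinset, SimpleGraph.edgeFinset_card]
  exact congrArg (· + 1) (Fintype.card_congr (.ofBijective _ (bijective_edge_of_isOrientation hE')))

theorem exists_isSide [Finite V] (hG : G.IsTree) (hE' : G.IsOrientation E') (f : E') :
    ∃ S : Finset V, IsSide f S := by
  classical
  have := Fintype.ofFinite V
  refine ⟨Finset.univ.filter ((G.deleteEdges {s(f.1.1, f.1.2)}).Reachable f.1.1), by simp, ?_,
    fun g hgf => ?_⟩
  · have hbridge := SimpleGraph.isAcyclic_iff_forall_adj_isBridge.1 hG.isAcyclic (hE'.1 _ _ f.2)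
    simpa only [Finset.mem_filter_univ] using SimpleGraph.isBridge_iff.1 hbridge
  · have hadj : (G.deleteEdges {s(f.1.1, f.1.2)}).Adj g.1.1 g.1.2 :=
      SimpleGraph.deleteEdges_adj.2 ⟨hE'.1 _ _ g.2,
        fun h => hgf ((bijective_edge_of_isOrientation hE').injective (Subtype.ext h))⟩
    simp only [Finset.mem_filter_univ]
    exact ⟨fun h => h.trans hadj.reachable, fun h => h.trans hadj.reachable.symm⟩

section LetterAct

variable [DecidableEq V]

/-- The action of the states `f` of the automaton on letters: the transposition of the ends
of `f`. -/
def letterAct (f : E') : V → V := Equiv.swap f.1.1 f.1.2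

theorem actionGraph_letterAct (hE' : G.IsOrientation E') :
    actionGraph (letterAct : E' → V → V) = G := by
  have exists_letterAct_iff {x y : V} (hxy : x ≠ y) :
      (∃ f : E', letterAct f x = y) ↔ (x, y) ∈ E' ∨ (y, x) ∈ E' := by
    constructor
    · rintro ⟨⟨⟨z, t⟩, hf⟩, rfl⟩
      simp only [letterAct, Equiv.swap_apply_def] at hxy ⊢
      split_ifs at hxy ⊢ with h1 h2
      · exact .inl (h1 ▸ hf)
      · exact .inr (h2 ▸ hf)
      · exact absurd rfl hxy
    · rintro (h | h)
      · exact ⟨⟨_, h⟩, Equiv.swap_apply_left _ _⟩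
      · exact ⟨⟨_, h⟩, Equiv.swap_apply_right _ _⟩
  ext x y
  rw [actionGraph, SimpleGraph.fromRel_adj]
  constructor
  · rintro ⟨hxy, h⟩
    rw [exists_letterAct_iff hxy, exists_letterAct_iff hxy.symm, or_comm (a := (y, x) ∈ E'),
      or_self] at h
    exact h.elim (hE'.1 _ _) fun h => (hE'.1 _ _ h).symm
  · intro h
    exact ⟨h.ne, .inl ((exists_letterAct_iff h.ne).2 (hE'.2 _ _ h).or)⟩

theorem IsSide.isGatedCycle {f : E'} {S : Finset V} (hS : IsSide f S) :
    IsGatedCycle (m := 1) letterAct f {f.1.1, f.1.2} fun z => if z ∈ S then 0 else 1 where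
  mapsTo := by rintro _ (rfl | rfl) <;> simp [letterAct]
  injOn := by
    rintro _ (rfl | rfl) _ (rfl | rfl) <;> simp [hS.left, hS.right]
  rotate := by
    rintro _ (rfl | rfl)
    · simp [letterAct, hS.left, hS.right]
    · simp only [letterAct, Equiv.swap_apply_right, hS.left, hS.right, if_true, if_false]
      decide
  fix g z hgz := by
    simp only [letterAct, Equiv.swap_apply_def]
    split_ifs <;> grind [hS.mem_iff_mem g]

end LetterAct

theorem IsSide.szegedTerm_eq [Fintype V] (hG : G.Connected) (hE' : G.IsOrientation E') {f : E'}
    {S : Finset V} (hS : IsSide f S) :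
    (Graph.ofSimpleGraph G).szegedTerm ⟨s(f.1.1, f.1.2), hE'.1 _ _ f.2⟩ =
      S.card * (Fintype.card V - S.card) := by
  classical
  obtain rfl := actionGraph_letterAct hE'
  have hval (z : V) :
      ((0 : ZMod (2 * 1)) - if z ∈ S then 0 else 1).val < 1 ↔ z ∈ S := by
    split_ifs with h <;> simp only [h, iff_true, iff_false] <;> decide
  have hoffcut : offcut (actionGraph (letterAct : E' → V → V)) f.1.2 f.1.1 (letterAct f f.1.1) =
      S.card := by
    have hset := hS.isGatedCycle.offcut_eq hG (.inl rfl) f.1.2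
    simp only [if_pos hS.left, hval] at hset
    simp only [hS.right, iff_false, not_not] at hset
    exact hset.trans (Set.ncard_coe_finset S)
  have hterm := szegedTerm_eq_offcut (Graph.toSimpleGraphOfSimpleGraphIso _) hG f.1.2
    (e := ⟨s(f.1.1, f.1.2), hE'.1 _ _ f.2⟩) (u := ⟨f.1.1, trivial⟩) (v := ⟨f.1.2, trivial⟩)
    ⟨rfl, hE'.1 _ _ f.2⟩ (Equiv.swap_apply_left _ _).symm
    (.inr ⟨1, inferInstance, _, _, hS.isGatedCycle, .inl rfl⟩)
  rw [hterm, Nat.card_eq_fintype_card]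
  exact congrArg (fun s => s * (Fintype.card V - s)) hoffcut

theorem szeged_ofSimpleGraph_eq_sum [Fintype V] [Fintype E'] (hG : G.Connected)
    (hE' : G.IsOrientation E') {S : E' → Finset V} (hS : ∀ f, IsSide f (S f)) :
    (Graph.ofSimpleGraph G).szeged = ∑ f : E', (S f).card * (Fintype.card V - (S f).card) := by
  rw [Graph.szeged, ← finsum_eq_of_bijective _ (bijective_edge_of_isOrientation hE') fun f =>
    ((hS f).szegedTerm_eq hG hE').symm, finsum_eq_sum_of_fintype]

end Tree

section Words

local notation:67 w:67 "⊳" z:68 => Fin.snoc (α := fun _ => _) w z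

variable {V : Type*} {n : ℕ} {w : Fin n → V} {z a : V}

theorem snoc_const (n : ℕ) (a : V) : (fun _ : Fin n => a) ⊳ a = fun _ => a := by
  ext i
  refine Fin.lastCases ?_ (fun j => ?_) i <;> simp

theorem snoc_eq_const_iff : w ⊳ z = (fun _ => a) ↔ w = (fun _ => a) ∧ z = a := by
  rw [← snoc_const n a, Fin.snoc_inj]

theorem cons_eq_const_iff :
    (Fin.cons z w : Fin (n + 1) → V) = (fun _ => a) ↔ z = a ∧ w = fun _ => a := by
  simp [funext_iff, Fin.forall_fin_succ]

theorem sum_univ_snoc {M : Type*} [AddCommMonoid M] [Fintype V] (F : (Fin (n + 1) → V) → M) :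
    ∑ v, F v = ∑ w : Fin n → V, ∑ z, F (w ⊳ z) := by
  rw [← (Fin.snocEquiv fun _ => V).sum_comp, Fintype.sum_prod_type_right]
  rfl

theorem ncard_setOf_snoc [Fintype V] {P : (Fin (n + 1) → V) → Prop} {q : ℕ}
    (hq : ∀ w : Fin n → V, {z | P (w ⊳ z)}.ncard = q) :
    {v | P v}.ncard = Fintype.card V ^ n * q := by
  classical
  simp only [Set.ncard_eq_toFinset_card', Set.toFinset_ofPred, Finset.card_filter] at hq ⊢
  simp only [sum_univ_snoc, hq, Finset.sum_const, Finset.card_univ, Fintype.card_fun,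
    Fintype.card_fin, smul_eq_mul]

variable [DecidableEq V] {E' : Set (V × V)}

section EdgeAct

/-- The words over the two ends of the oriented edge `f`. -/
def edgeWords (f : E') (n : ℕ) : Finset (Fin n → V) :=
  Fintype.piFinset fun _ => {f.1.1, f.1.2}

theorem snoc_mem_edgeWords {f : E'} :
    w ⊳ z ∈ edgeWords f (n + 1) ↔ w ∈ edgeWords f n ∧ z ∈ ({f.1.1, f.1.2} : Finset V) := by
  simp only [edgeWords, Fintype.mem_piFinset, Fin.forall_fin_succ', Fin.snoc_castSucc,
    Fin.snoc_last]

theorem const_left_mem_edgeWords (f : E') (n : ℕ) : (fun _ => f.1.1) ∈ edgeWords f n := by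
  simp [edgeWords]

theorem card_edgeWords {f : E'} (hf : f.1.1 ≠ f.1.2) (n : ℕ) : (edgeWords f n).card = 2 ^ n := by
  rw [edgeWords, Fintype.card_piFinset_const, Finset.card_pair hf]

/-- The action of the oriented edge `f`, as a state of the automaton, on words of length `n`. -/
def edgeAct (f : E') (w : Fin n → V) : Fin n → V :=
  (graphAutomaton E').act n (some f) w

theorem act_none (w : Fin n → V) : (graphAutomaton E').act n none w = w := by
  induction n with
  | zero => rfl
  | succ n ih =>
    exact (congrArg (Fin.cons (α := fun _ => V) (w 0)) (ih _)).trans (Fin.cons_self_tail w)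

theorem out_some (f : E') (z : V) : (graphAutomaton E').out (some f) z = letterAct f z := by
  simp [graphAutomaton, letterAct, Equiv.swap_apply_def]

theorem edgeAct_cons (f : E') (z : V) (w : Fin n → V) :
    edgeAct f (Fin.cons z w : Fin (n + 1) → V) =
      Fin.cons (letterAct f z) (if z = f.1.1 then edgeAct f w else w) := by
  rw [← out_some]
  change (Fin.cons _ ((graphAutomaton E').act n
    (if z = f.1.1 then some f else none) w) : Fin (n + 1) → V) = _
  split_ifs
  · rfl
  · rw [act_none]
    rfl

theorem edgeAct_snoc (f : E') (w : Fin n → V) (z : V) :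
    edgeAct f (w ⊳ z) = edgeAct f w ⊳ if w = (fun _ => f.1.1) then letterAct f z else z := by
  induction n with
  | zero =>
    rw [if_pos (Subsingleton.elim _ _), ← out_some]
    ext i
    rw [Fin.fin_one_eq_zero i]
    rfl
  | succ n ih =>
    cases w using Fin.consCases with
    | cons x w =>
    rw [← Fin.cons_snoc_eq_snoc_cons, edgeAct_cons, edgeAct_cons, ← Fin.cons_snoc_eq_snoc_cons]
    by_cases hx : x = f.1.1 <;> simp only [hx, cons_eq_const_iff, true_and, false_and, if_true,
      if_false, ih]

theorem letterAct_left (f : E') : letterAct f f.1.1 = f.1.2 :=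
  Equiv.swap_apply_left _ _

theorem edgeAct_const_left (f : E') (n : ℕ) :
    edgeAct f (fun _ : Fin n => f.1.1) = fun _ => f.1.2 := by
  induction n with
  | zero => exact Subsingleton.elim _ _
  | succ n ih => rw [← snoc_const, edgeAct_snoc, ih, if_pos rfl, letterAct_left, snoc_const]

theorem letterAct_of_notMem {f : E'} (hz : z ∉ ({f.1.1, f.1.2} : Finset V)) :
    letterAct f z = z := by
  simp only [Finset.mem_insert, Finset.mem_singleton, not_or] at hz
  exact Equiv.swap_apply_of_ne_of_ne hz.1 hz.2

theorem edgeAct_snoc_of_notMem {f : E'} (hw : w ∉ edgeWords f n) (z : V) :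
    edgeAct f (w ⊳ z) = edgeAct f w ⊳ z := by
  rw [edgeAct_snoc, if_neg]
  rintro rfl
  exact hw (const_left_mem_edgeWords f n)

theorem edgeAct_mem_edgeWords {f : E'} (hw : w ∈ edgeWords f n) : edgeAct f w ∈ edgeWords f n := by
  induction n with
  | zero => exact Subsingleton.elim w _ ▸ hw
  | succ n ih =>
    cases w using Fin.snocCases with
    | snoc w z =>
    rw [snoc_mem_edgeWords] at hw
    rw [edgeAct_snoc, snoc_mem_edgeWords]
    refine ⟨ih hw.1, ?_⟩
    obtain ⟨-, hz⟩ := hw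
    rw [Finset.mem_insert, Finset.mem_singleton] at hz
    rcases hz with rfl | rfl <;> split_ifs <;> simp [letterAct]

theorem apply_edgeAct_snoc {α : Type*} (F : (Fin (n + 1) → V) → α) (f : E')
    (hF : ∀ z, F (edgeAct f w ⊳ z) = F (w ⊳ z))
    (hconst : w = (fun _ => f.1.1) → F (fun _ => f.1.2) = F (fun _ => f.1.1)) (z : V) :
    F (edgeAct f (w ⊳ z)) = F (w ⊳ z) := by
  rw [edgeAct_snoc]
  split_ifs with hw
  · subst hw
    specialize hconst rfl
    rw [edgeAct_const_left] at hF ⊢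
    rw [← snoc_const n f.1.1, ← snoc_const n f.1.2] at hconst
    simp only [letterAct, Equiv.swap_apply_def]
    split_ifs with hx hy
    · rw [hx, hconst]
    · rw [hy, hF, ← hF f.1.2, hconst]
    · exact hF z
  · exact hF z

/-- The graph underlying the Schreier graph of the words of length `n`. -/
abbrev wordGraph (E' : Set (V × V)) (n : ℕ) : SimpleGraph (Fin n → V) :=
  actionGraph (edgeAct : E' → (Fin n → V) → Fin n → V)

theorem wordGraph_connected (hV : (actionGraph (letterAct : E' → V → V)).Connected) (n : ℕ) :
    (wordGraph E' n).Connected := by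
  have := hV.nonempty
  refine ⟨fun v w => ?_⟩
  induction n with
  | zero => rw [Subsingleton.elim v w]
  | succ n ih =>
    have hhead (u : Fin n → V) (z z' : V) :
        (wordGraph E' (n + 1)).Reachable (Fin.cons z u) (Fin.cons z' u) := by
      refine reachable_map_of_reachable (fun z => (Fin.cons z u : Fin (n + 1) → V))
        (fun f z => ?_) (hV z z')
      rcases ne_or_eq z f.1.1 with hz | rfl
      · have hstep := reachable_apply edgeAct f (Fin.cons z u : Fin (n + 1) → V)
        rwa [edgeAct_cons, if_neg hz] at hstep
      · rw [letterAct_left]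
        rcases ne_or_eq f.1.2 f.1.1 with hy | hy
        · have hstep := reachable_apply edgeAct f (Fin.cons f.1.2 u : Fin (n + 1) → V)
          rw [edgeAct_cons, if_neg hy, letterAct, Equiv.swap_apply_right] at hstep
          exact hstep.symm
        · rw [hy]
    have htail (z : V) (u u' : Fin n → V) :
        (wordGraph E' (n + 1)).Reachable (Fin.cons z u) (Fin.cons z u') := by
      refine reachable_map_of_reachable (fun u => (Fin.cons z u : Fin (n + 1) → V))
        (fun f u => ?_) (ih u u')
      have hstep := reachable_apply edgeAct f (Fin.cons f.1.1 u : Fin (n + 1) → V)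
      rw [edgeAct_cons, if_pos rfl] at hstep
      exact (hhead _ _ _).trans (hstep.trans (hhead _ _ _))
    rw [← Fin.cons_self_tail v, ← Fin.cons_self_tail w]
    exact (hhead _ _ _).trans (htail _ _ _)

end EdgeAct

variable {f g : E'} {S : Finset V}

section GateRank

/-- The position, counted from the word `y ^ n`, of the gate of a word on the cycle `edgeWords f n`,
where `f = (x, y)` and `S` is the side of `x`. The edge acts on this cycle as a binary odometer: the
letters `x` and `y` are the digits `1` and `0`, the last letter being the leading digit. A word with
another last letter has the gate `x ^ n` or `y ^ n`, according to the side of this letter. -/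
def gateRank (f : E') (S : Finset V) : {n : ℕ} → (Fin n → V) → ℕ
  | 0, _ => 0
  | n + 1, w =>
    if w (Fin.last n) = f.1.1 then 2 ^ n + gateRank f S (Fin.init w)
    else if w (Fin.last n) = f.1.2 then gateRank f S (Fin.init w)
    else if w (Fin.last n) ∈ S then 2 ^ (n + 1) - 1 else 0

theorem gateRank_snoc (w : Fin n → V) (z : V) :
    gateRank f S (w ⊳ z) = if z = f.1.1 then 2 ^ n + gateRank f S w
      else if z = f.1.2 then gateRank f S w else if z ∈ S then 2 ^ (n + 1) - 1 else 0 := by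
  simp only [gateRank, Fin.snoc_last, Fin.init_snoc]

theorem gateRank_snoc_congr {w' : Fin n → V} (h : gateRank f S w = gateRank f S w') (z : V) :
    gateRank f S (w ⊳ z) = gateRank f S (w' ⊳ z) := by
  simp only [gateRank_snoc, h]

theorem gateRank_lt (f : E') (S : Finset V) (w : Fin n → V) : gateRank f S w < 2 ^ n := by
  induction n with
  | zero => exact Nat.one_pos
  | succ n ih =>
    have hlt := ih (Fin.init w)
    rw [gateRank, pow_succ]
    split_ifs <;> omega

theorem gateRank_snoc_left (w : Fin n → V) :
    gateRank f S (w ⊳ f.1.1) = 2 ^ n + gateRank f S w := by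
  rw [gateRank_snoc, if_pos rfl]

theorem IsSide.gateRank_snoc_right (hS : IsSide f S) (w : Fin n → V) :
    gateRank f S (w ⊳ f.1.2) = gateRank f S w := by
  rw [gateRank_snoc, if_neg hS.ne.symm, if_pos rfl]

theorem gateRank_snoc_of_notMem (hz : z ∉ ({f.1.1, f.1.2} : Finset V)) (w : Fin n → V) :
    gateRank f S (w ⊳ z) = if z ∈ S then 2 ^ (n + 1) - 1 else 0 := by
  simp only [Finset.mem_insert, Finset.mem_singleton, not_or] at hz
  rw [gateRank_snoc, if_neg hz.1, if_neg hz.2]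

theorem IsSide.gateRank_const (hS : IsSide f S) (n : ℕ) (a : V) :
    gateRank f S (fun _ : Fin n => a) = if a ∈ S then 2 ^ n - 1 else 0 := by
  induction n with
  | zero => exact (ite_self 0).symm
  | succ n ih =>
    have hpow : 0 < 2 ^ n := by positivity
    rw [← snoc_const, gateRank_snoc, ih, pow_succ]
    have hleft := hS.left
    have hright := hS.right
    split_ifs <;> grind

theorem IsSide.gateRank_injOn (hS : IsSide f S) (n : ℕ) :
    Set.InjOn (gateRank f S) (edgeWords f n : Set (Fin n → V)) := by
  induction n with
  | zero => exact fun _ _ _ _ _ => Subsingleton.elim _ _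
  | succ n ih =>
    intro v hv w hw hvw
    cases v using Fin.snocCases with | snoc v a =>
    cases w using Fin.snocCases with | snoc w b =>
    simp only [Finset.mem_coe, snoc_mem_edgeWords, Finset.mem_insert, Finset.mem_singleton] at hv hw
    have hvlt := gateRank_lt f S v
    have hwlt := gateRank_lt f S w
    obtain ⟨hv, rfl | rfl⟩ := hv <;> obtain ⟨hw, rfl | rfl⟩ := hw <;>
      simp only [gateRank_snoc_left, hS.gateRank_snoc_right] at hvw
    · rw [ih hv hw (Nat.add_left_cancel hvw)]
    · omega
    · omega
    · rw [ih hv hw hvw]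

theorem IsSide.gateRank_edgeAct_of_ne (hS : IsSide f S) (hgf : g ≠ f) (w : Fin n → V) :
    gateRank f S (edgeAct g w) = gateRank f S w := by
  induction n with
  | zero => rfl
  | succ n ih =>
    cases w using Fin.snocCases with | snoc w z =>
    refine apply_edgeAct_snoc _ g (gateRank_snoc_congr (ih w)) (fun _ => ?_) z
    simp only [hS.gateRank_const, hS.mem_iff_mem g hgf]

theorem gateRank_edgeAct_of_notMem (hw : w ∉ edgeWords f n) :
    gateRank f S (edgeAct f w) = gateRank f S w := by
  induction n with
  | zero => rfl
  | succ n ih =>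
    cases w using Fin.snocCases with | snoc w z =>
    by_cases hw' : w ∈ edgeWords f n
    · have hz := fun hz => hw (snoc_mem_edgeWords.2 ⟨hw', hz⟩)
      rw [edgeAct_snoc, letterAct_of_notMem hz, ite_self, gateRank_snoc_of_notMem hz,
        gateRank_snoc_of_notMem hz]
    · rw [edgeAct_snoc_of_notMem hw']
      exact gateRank_snoc_congr (ih hw') z

theorem IsSide.gateRank_edgeAct_of_mem (hS : IsSide f S) (hw : w ∈ edgeWords f n) :
    gateRank f S (edgeAct f w) = if w = (fun _ => f.1.1) then 0 else gateRank f S w + 1 := by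
  split_ifs with hconst
  · rw [hconst, edgeAct_const_left, hS.gateRank_const, if_neg hS.right]
  induction n with
  | zero => exact (hconst (Subsingleton.elim _ _)).elim
  | succ n ih =>
    cases w using Fin.snocCases with | snoc w z =>
    obtain ⟨hw', hz⟩ := snoc_mem_edgeWords.1 hw
    rw [edgeAct_snoc]
    split_ifs with hwx
    · subst hwx
      have hzy : z = f.1.2 := by
        simp only [Finset.mem_insert, Finset.mem_singleton] at hz
        exact hz.resolve_left fun h => hconst (snoc_eq_const_iff.2 ⟨rfl, h⟩)
      have hpow : 0 < 2 ^ n := by positivity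
      rw [hzy, letterAct, Equiv.swap_apply_right, edgeAct_const_left, gateRank_snoc_left,
        hS.gateRank_snoc_right, hS.gateRank_const, hS.gateRank_const, if_neg hS.right,
        if_pos hS.left]
      omega
    · simp only [Finset.mem_insert, Finset.mem_singleton] at hz
      rcases hz with rfl | rfl
      · rw [gateRank_snoc_left, gateRank_snoc_left, ih hw' hwx, add_assoc]
      · rw [hS.gateRank_snoc_right, hS.gateRank_snoc_right, ih hw' hwx]

theorem IsSide.gateRank_add_one_eq_iff (hS : IsSide f S) (hw : w ∈ edgeWords f n) :
    gateRank f S w + 1 = 2 ^ n ↔ w = fun _ => f.1.1 := by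
  have hpow : 0 < 2 ^ n := by positivity
  have hrank := hS.gateRank_const n f.1.1
  rw [if_pos hS.left] at hrank
  constructor
  · intro h
    exact hS.gateRank_injOn n hw (const_left_mem_edgeWords f n) (by omega)
  · rintro rfl
    omega

theorem IsSide.isGatedCycle_edgeWords (hS : IsSide f S) (n : ℕ) :
    IsGatedCycle edgeAct f (edgeWords f (n + 1) : Set (Fin (n + 1) → V))
      fun w => (gateRank f S w : ZMod (2 * 2 ^ n)) where
  mapsTo _ hw := edgeAct_mem_edgeWords hw
  injOn v hv w hw hvw := by
    refine hS.gateRank_injOn _ hv hw ?_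
    have hvlt := gateRank_lt f S v
    have hwlt := gateRank_lt f S w
    rw [pow_succ'] at hvlt hwlt
    rwa [ZMod.natCast_eq_natCast_iff', Nat.mod_eq_of_lt hvlt, Nat.mod_eq_of_lt hwlt] at hvw
  rotate w hw := by
    rw [hS.gateRank_edgeAct_of_mem hw, ← Nat.cast_succ]
    split_ifs with hconst
    · rw [Nat.succ_eq_add_one, (hS.gateRank_add_one_eq_iff hw).2 hconst, pow_succ',
        ZMod.natCast_self, Nat.cast_zero]
    · rfl
  fix g w hgw := by
    by_cases hgf : g = f
    · subst hgf
      rw [gateRank_edgeAct_of_notMem (hgw.resolve_left (not_not_intro rfl))]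
    · rw [hS.gateRank_edgeAct_of_ne hgf]

end GateRank

section SnocExtend

/-- The coordinate `T` of a gated cycle of words, carried over to the words with one more letter:
the cycle is copied with `z` as last letter, and it is entered from the words with another last
letter through `z ^ (n + 1)`. -/
def snocExtend {α : Type*} (z : V) (T : (Fin n → V) → α) (w : Fin (n + 1) → V) : α :=
  if w (Fin.last n) = z then T (Fin.init w) else T fun _ => z

theorem snocExtend_snoc {α : Type*} (T : (Fin n → V) → α) (z : V) (w : Fin n → V) (a : V) :
    snocExtend z T (w ⊳ a) = if a = z then T w else T fun _ => z := by
  simp only [snocExtend, Fin.snoc_last, Fin.init_snoc]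

theorem snocExtend_const {α : Type*} (T : (Fin n → V) → α) (z a : V) :
    snocExtend z T (fun _ => a) = T fun _ => z := by
  rw [← snoc_const, snocExtend_snoc]
  split_ifs with h
  · rw [h]
  · rfl

theorem IsGatedCycle.letterAct_eq_self {m : ℕ} {C : Set (Fin n → V)}
    {T : (Fin n → V) → ZMod (2 * m)} (h : IsGatedCycle edgeAct f C T)
    (hz : letterAct f z = z ∨ ∀ a b, T (fun _ => a) = T fun _ => b) (hw : w ∈ C)
    (hwx : w = fun _ => f.1.1) : letterAct f z = z := by
  refine hz.resolve_right fun hT => ?_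
  subst hwx
  have hone : ((1 : ℕ) : ZMod (2 * m)) ≠ 0 := by
    rw [Ne, ZMod.natCast_eq_zero_iff, Nat.dvd_one]
    omega
  have hrot := h.rotate _ hw
  rw [edgeAct_const_left, hT f.1.2 f.1.1, left_eq_add] at hrot
  exact hone (Nat.cast_one.trans hrot)

theorem IsGatedCycle.edgeAct_snoc_of_mem {m : ℕ} {C : Set (Fin n → V)}
    {T : (Fin n → V) → ZMod (2 * m)} (h : IsGatedCycle edgeAct f C T)
    (hz : letterAct f z = z ∨ ∀ a b, T (fun _ => a) = T fun _ => b) (hw : w ∈ C) :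
    edgeAct f (w ⊳ z) = edgeAct f w ⊳ z := by
  rw [edgeAct_snoc]
  split_ifs with hwx
  · rw [h.letterAct_eq_self hz hw hwx]
  · rfl

theorem IsGatedCycle.snocExtend {m : ℕ} {C : Set (Fin n → V)}
    {T : (Fin n → V) → ZMod (2 * m)} (h : IsGatedCycle edgeAct f C T)
    (hz : letterAct f z = z ∨ ∀ a b, T (fun _ => a) = T fun _ => b) :
    IsGatedCycle edgeAct f ((· ⊳ z) '' C) (snocExtend z T) where
  mapsTo := by
    rintro _ ⟨w, hw, rfl⟩
    exact ⟨edgeAct f w, h.mapsTo hw, (h.edgeAct_snoc_of_mem hz hw).symm⟩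
  injOn := by
    rintro _ ⟨v, hv, rfl⟩ _ ⟨w, hw, rfl⟩ hvw
    simp only [snocExtend_snoc, if_true] at hvw
    exact congrArg (· ⊳ z) (h.injOn hv hw hvw)
  rotate := by
    rintro _ ⟨w, hw, rfl⟩
    simp only [h.edgeAct_snoc_of_mem hz hw, snocExtend_snoc, if_true, h.rotate w hw]
  fix g w hgw := by
    cases w using Fin.snocCases with | snoc w a =>
    by_cases hgC : g = f ∧ w ∈ C
    · obtain ⟨rfl, hw⟩ := hgC
      have haz : a ≠ z := by
        rintro rfl
        exact hgw.elim (· rfl) (· ⟨w, hw, rfl⟩)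
      rw [edgeAct_snoc, snocExtend_snoc, snocExtend_snoc, if_neg haz, if_neg]
      split_ifs with hwx
      · intro haz'
        exact haz ((Equiv.swap _ _).injective (haz'.trans (h.letterAct_eq_self hz hw hwx).symm))
      · exact haz
    · refine apply_edgeAct_snoc _ g (fun b => ?_) (fun _ => ?_) a
      · rw [snocExtend_snoc, snocExtend_snoc, h.fix g w (not_and_or.1 hgC)]
      · rw [snocExtend_const, snocExtend_const]

theorem IsSide.exists_isGatedCycle_of_notMem (hS : IsSide f S) {w : Fin n → V}
    (hw : w ∉ edgeWords f n) : edgeAct f w = w ∨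
      ∃ (m : ℕ) (_ : NeZero m) (C : Set (Fin n → V)) (T : (Fin n → V) → ZMod (2 * m)),
        IsGatedCycle edgeAct f C T ∧ w ∈ C ∧ ∀ a b, T (fun _ => a) = T fun _ => b := by
  induction n with
  | zero => exact .inl (Subsingleton.elim _ _)
  | succ n ih =>
    cases w using Fin.snocCases with | snoc w z =>
    by_cases hw' : w ∈ edgeWords f n
    · have hz := letterAct_of_notMem fun hz => hw (snoc_mem_edgeWords.2 ⟨hw', hz⟩)
      cases n with
      | zero => exact .inl (by rw [edgeAct_snoc, hz, ite_self, Subsingleton.elim (edgeAct f w) w])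
      | succ n =>
        exact .inr ⟨_, inferInstance, _, _, (hS.isGatedCycle_edgeWords n).snocExtend (.inl hz),
          ⟨w, hw', rfl⟩, fun a b => by rw [snocExtend_const, snocExtend_const]⟩
    · refine (ih hw').imp (fun hfix => ?_) fun ⟨m, hm, C, T, hC, hwC, hT⟩ => ?_
      · rw [edgeAct_snoc_of_notMem hw', hfix]
      · exact ⟨m, hm, _, _, hC.snocExtend (.inr hT), ⟨w, hwC, rfl⟩,
          fun a b => by rw [snocExtend_const, snocExtend_const]⟩

theorem IsSide.exists_isGatedCycle (hS : IsSide f S) (w : Fin n → V) : edgeAct f w = w ∨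
      ∃ (m : ℕ) (_ : NeZero m) (C : Set (Fin n → V)) (T : (Fin n → V) → ZMod (2 * m)),
        IsGatedCycle edgeAct f C T ∧ w ∈ C := by
  by_cases hw : w ∈ edgeWords f n
  · cases n with
    | zero => exact .inl (Subsingleton.elim _ _)
    | succ n => exact .inr ⟨_, inferInstance, _, _, hS.isGatedCycle_edgeWords n, hw⟩
  · exact (hS.exists_isGatedCycle_of_notMem hw).imp_right
      fun ⟨m, hm, C, T, hC, hwC, _⟩ => ⟨m, hm, C, T, hC, hwC⟩

theorem ncard_setOf_snocExtend {α : Type*} (T : (Fin n → V) → α) (z : V) (P : α → Prop) :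
    {v | ¬ (P (snocExtend z T v) ↔ P (T fun _ => z))}.ncard =
      {v | ¬ (P (T v) ↔ P (T fun _ => z))}.ncard := by
  rw [← Set.ncard_image_of_injective _ (Fin.snoc_left_injective (n := n) (α := fun _ => V) z)]
  refine congrArg Set.ncard (Set.ext fun v => ?_)
  cases v using Fin.snocCases with | snoc v a =>
  simp only [Set.mem_ofPred_eq, snocExtend_snoc, Set.mem_image, Fin.snoc_inj]
  split_ifs with ha <;> aesop

end SnocExtend

section EdgeOffcut

theorem ncard_setOf_eq_card {x y : V} {P : V → Prop} {Q : Finset V} (hP : P x ↔ ¬ P y)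
    (hQ : x ∈ Q ↔ y ∉ Q) (h : ∀ z ∉ ({x, y} : Finset V), P z ↔ z ∈ Q) :
    {z | P z}.ncard = Q.card := by
  rw [← Set.ncard_coe_finset]
  by_cases hx : P x ↔ x ∈ Q
  · congr 1
    ext z
    by_cases hz : z ∈ ({x, y} : Finset V) <;> grind
  · rw [← Set.ncard_image_of_injective _ (Equiv.swap x y).injective]
    congr 1
    ext z
    rw [Equiv.image_eq_preimage_symm]
    simp only [Equiv.symm_swap, Equiv.swap_apply_def, Set.mem_preimage, Set.mem_ofPred_eq]
    by_cases hz : z ∈ ({x, y} : Finset V) <;> grind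

theorem IsSide.cast_gateRank_snoc_left_add (hS : IsSide f S) (w : Fin n → V) :
    (gateRank f S (w ⊳ f.1.1) : ZMod (2 * 2 ^ n)) =
      gateRank f S (w ⊳ f.1.2) + (2 ^ n : ℕ) := by
  rw [gateRank_snoc_left, hS.gateRank_snoc_right, Nat.cast_add, add_comm]

theorem cast_two_pow_succ_sub_one (n : ℕ) : ((2 ^ (n + 1) - 1 : ℕ) : ZMod (2 * 2 ^ n)) = -1 := by
  rw [Nat.cast_sub Nat.one_le_two_pow, pow_succ', ZMod.natCast_self, Nat.cast_one, zero_sub]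

theorem IsSide.ncard_val_sub_gateRank_eq_mul_card [Fintype V] (hS : IsSide f S)
    (t : ZMod (2 * 2 ^ n)) (b : V) {Q : Finset V} (hQ : f.1.1 ∈ Q ↔ f.1.2 ∉ Q)
    (h : ∀ z ∉ ({f.1.1, f.1.2} : Finset V),
      ¬ ((if z ∈ S then t + 1 else t).val < 2 ^ n ↔
        (if b ∈ S then t + 1 else t).val < 2 ^ n) ↔ z ∈ Q) :
    {v : Fin (n + 1) → V | ¬ ((t - gateRank f S v).val < 2 ^ n ↔
        (t - gateRank f S fun _ : Fin (n + 1) => b).val < 2 ^ n)}.ncard =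
      Fintype.card V ^ n * Q.card := by
  have hcast (a : V) : t - ((if a ∈ S then 2 ^ (n + 1) - 1 else 0 : ℕ) : ZMod (2 * 2 ^ n)) =
      if a ∈ S then t + 1 else t := by
    rw [apply_ite Nat.cast, cast_two_pow_succ_sub_one, Nat.cast_zero, apply_ite (t - ·),
      sub_neg_eq_add, sub_zero]
  have hflip (w : Fin n → V) : (t - gateRank f S (w ⊳ f.1.2)).val < 2 ^ n ↔
      ¬ (t - gateRank f S (w ⊳ f.1.1)).val < 2 ^ n := by
    rw [← val_add_half_lt_iff, hS.cast_gateRank_snoc_left_add, sub_add_eq_sub_sub, sub_add_cancel]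
  refine ncard_setOf_snoc fun w => ncard_setOf_eq_card (y := f.1.2) ?_ hQ fun z hz => ?_
  · rw [hflip]
    tauto
  · rw [hS.gateRank_const, hcast, gateRank_snoc_of_notMem hz, hcast, h z hz]

theorem IsSide.ncard_val_sub_gateRank [Fintype V] (hS : IsSide f S) (t : ZMod (2 * 2 ^ n))
    (b : V) : {v : Fin (n + 1) → V | ¬ ((t - gateRank f S v).val < 2 ^ n ↔
        (t - gateRank f S fun _ : Fin (n + 1) => b).val < 2 ^ n)}.ncard =
      Fintype.card V ^ n * if (t + 1).val < 2 ^ n ↔ t.val < 2 ^ n then 1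
        else if b ∈ S then Sᶜ.card else S.card := by
  have hleft := hS.left
  have hright := hS.right
  split_ifs with hAB hb
  · rw [← Finset.card_singleton f.1.1]
    refine hS.ncard_val_sub_gateRank_eq_mul_card t b (by simp [hS.ne.symm]) fun z hz => ?_
    split_ifs <;> grind
  · refine hS.ncard_val_sub_gateRank_eq_mul_card t b (by simp [hleft, hright]) fun z _ => ?_
    rw [if_pos hb, Finset.mem_compl]
    split_ifs <;> tauto
  · refine hS.ncard_val_sub_gateRank_eq_mul_card t b (by simp [hleft, hright]) fun z _ => ?_
    rw [if_neg hb]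
    split_ifs <;> tauto

theorem IsSide.val_gateRank_add_one_lt_iff (hS : IsSide f S) (hw : w ∈ edgeWords f n)
    (hz : z ∈ ({f.1.1, f.1.2} : Finset V)) :
    (((gateRank f S (w ⊳ z) : ZMod (2 * 2 ^ n)) + 1).val < 2 ^ n ↔
      (gateRank f S (w ⊳ z) : ZMod (2 * 2 ^ n)).val < 2 ^ n) ↔ w ≠ fun _ => f.1.1 := by
  have hsnoc_right : (((gateRank f S (w ⊳ f.1.2) : ZMod (2 * 2 ^ n)) + 1).val < 2 ^ n ↔
      (gateRank f S (w ⊳ f.1.2) : ZMod (2 * 2 ^ n)).val < 2 ^ n) ↔ w ≠ fun _ => f.1.1 := by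
    have hlt := gateRank_lt f S w
    rw [hS.gateRank_snoc_right, val_add_one_eq_ite, ZMod.val_cast_of_lt (by omega),
      if_neg (by omega), Ne, ← hS.gateRank_add_one_eq_iff hw]
    omega
  simp only [Finset.mem_insert, Finset.mem_singleton] at hz
  rcases hz with rfl | rfl
  · rwa [hS.cast_gateRank_snoc_left_add, add_right_comm, val_add_half_lt_iff, val_add_half_lt_iff,
      not_iff_not]
  · exact hsnoc_right

/-- The number of words which the edge of the Schreier graph that joins `w` to its image under
`f = (x, y)` separates from the word `x ^ n`. -/
noncomputable def edgeOffcut (f : E') (w : Fin n → V) : ℕ :=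
  offcut (wordGraph E' n) (fun _ => f.1.1) w (edgeAct f w)

theorem IsSide.edgeOffcut_snoc_of_mem [Fintype V] (hS : IsSide f S)
    (hV : (actionGraph (letterAct : E' → V → V)).Connected) (hw : w ∈ edgeWords f n)
    (hz : z ∈ ({f.1.1, f.1.2} : Finset V)) :
    edgeOffcut f (w ⊳ z) =
      Fintype.card V ^ n * if w = (fun _ => f.1.1) then Sᶜ.card else 1 := by
  rw [edgeOffcut, (hS.isGatedCycle_edgeWords n).offcut_eq (wordGraph_connected hV _)
    (snoc_mem_edgeWords.2 ⟨hw, hz⟩), hS.ncard_val_sub_gateRank, if_pos hS.left]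
  simp only [hS.val_gateRank_add_one_lt_iff hw hz, ne_eq, ite_not]

theorem IsSide.edgeOffcut_snoc_snoc [Fintype V] (hS : IsSide f S)
    (hV : (actionGraph (letterAct : E' → V → V)).Connected) (hw : w ∈ edgeWords f n)
    (hz : z ∈ ({f.1.1, f.1.2} : Finset V)) (ha : a ∉ ({f.1.1, f.1.2} : Finset V)) :
    edgeOffcut f ((w ⊳ z) ⊳ a) = Fintype.card V ^ n *
      if w = (fun _ => f.1.1) then if a ∈ S then Sᶜ.card else S.card else 1 := by
  have hwz := snoc_mem_edgeWords.2 ⟨hw, hz⟩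
  rw [edgeOffcut, ((hS.isGatedCycle_edgeWords n).snocExtend
    (.inl (letterAct_of_notMem ha))).offcut_eq (wordGraph_connected hV _) ⟨_, hwz, rfl⟩,
    snocExtend_const, snocExtend_snoc, if_pos rfl]
  refine (ncard_setOf_snocExtend _ a fun t =>
    ((gateRank f S (w ⊳ z) : ZMod (2 * 2 ^ n)) - t).val < 2 ^ n).trans ?_
  rw [hS.ncard_val_sub_gateRank]
  simp only [hS.val_gateRank_add_one_lt_iff hw hz, ne_eq, ite_not]

theorem IsSide.edgeOffcut_snoc_of_notMem (hS : IsSide f S)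
    (hV : (actionGraph (letterAct : E' → V → V)).Connected) (hw : w ∉ edgeWords f n) (z : V) :
    edgeOffcut f (w ⊳ z) = edgeOffcut f w := by
  rw [edgeOffcut, edgeOffcut, edgeAct_snoc_of_notMem hw]
  rcases hS.exists_isGatedCycle_of_notMem hw with hfix | ⟨m, _, C, T, hC, hwC, hT⟩
  · rw [hfix, offcut_self, offcut_self]
  · have hC' := hC.snocExtend (z := z) (.inr hT)
    rw [← edgeAct_snoc_of_notMem hw, hC'.offcut_eq (wordGraph_connected hV _) ⟨w, hwC, rfl⟩,
      hC.offcut_eq (wordGraph_connected hV _) hwC, snocExtend_const, snocExtend_snoc, if_pos rfl,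
      hT f.1.1 z]
    exact ncard_setOf_snocExtend T z fun t => (_ - t).val < m

theorem edgeOffcut_snoc_of_length_zero {w : Fin 0 → V}
    (hz : z ∉ ({f.1.1, f.1.2} : Finset V)) : edgeOffcut f (w ⊳ z) = 0 := by
  rw [edgeOffcut, edgeAct_snoc, letterAct_of_notMem hz, ite_self,
    Subsingleton.elim (edgeAct f w) w, offcut_self]

end EdgeOffcut

section SchreierGraph

theorem schreierGraph_adj_iff {v w : Fin n → V} (hvw : v ≠ w) :
    ((graphAutomaton E').schreierGraph n).Adj v w ↔
      (∃ f : E', edgeAct f v = w) ∨ ∃ f : E', edgeAct f w = v := by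
  constructor
  · rintro ⟨⟨q, u⟩, h⟩
    rcases q with - | f
    · have hloop : s(u, u) = s(v, w) := (congrArg (s(u, ·)) (act_none u)).symm.trans h
      exact (hvw (by grind)).elim
    · rcases Sym2.eq_iff.1 h with ⟨rfl, hw⟩ | ⟨rfl, hv⟩
      · exact .inl ⟨f, hw⟩
      · exact .inr ⟨f, hv⟩
  · rintro (⟨f, rfl⟩ | ⟨f, rfl⟩)
    · exact ⟨(some f, v), rfl⟩
    · exact ⟨(some f, w), Sym2.eq_swap⟩

/-- The words of length `n` are the vertices of the Schreier graph, whose underlying simple graph is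
the graph of the action of the oriented edges, since the state `id` only contributes loops. -/
def schreierGraphIso (E' : Set (V × V)) (n : ℕ) :
    ((graphAutomaton E').schreierGraph n).toSimpleGraph ≃g wordGraph E' n where
  toEquiv := Equiv.Set.univ _
  map_rel_iff' {v w} := by
    change (SimpleGraph.fromRel _).Adj v.1 w.1 ↔ _
    rw [SimpleGraph.fromRel_adj, Graph.toSimpleGraph_adj, Subtype.coe_ne_coe]
    refine and_congr_right fun hvw => (schreierGraph_adj_iff (Subtype.coe_ne_coe.2 hvw)).symm

theorem IsSide.szegedTerm_schreierGraph_eq [Fintype V] (hS : IsSide f S)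
    (hV : (actionGraph (letterAct : E' → V → V)).Connected) (w : Fin n → V) :
    (((graphAutomaton E').schreierGraph n).szegedTerm ⟨(some f, w), trivial⟩ : ℚ) =
      edgeOffcut f w * (Fintype.card V ^ n - edgeOffcut f w) := by
  have hterm := szegedTerm_eq_offcut (schreierGraphIso E' n) (wordGraph_connected hV n)
    (fun _ => f.1.1) (e := ⟨(some f, w), trivial⟩) (u := ⟨w, trivial⟩)
    (v := ⟨edgeAct f w, trivial⟩) rfl rfl (hS.exists_isGatedCycle w)
  rw [hterm, Nat.cast_mul, Nat.cast_sub (offcut_le _ _ _ _), Nat.card_eq_fintype_card,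
    Fintype.card_fun, Fintype.card_fin, Nat.cast_pow]
  rfl

theorem szeged_schreierGraph_eq_sum [Fintype V] [Fintype E'] {S : E' → Finset V}
    (hS : ∀ f, IsSide f (S f)) (hV : (actionGraph (letterAct : E' → V → V)).Connected) (n : ℕ) :
    (((graphAutomaton E').schreierGraph n).szeged : ℚ) =
      ∑ f : E', ∑ w : Fin n → V,
        (edgeOffcut f w : ℚ) * (Fintype.card V ^ n - edgeOffcut f w) := by
  have hfinsum := finsum_comp_equiv (Equiv.Set.univ (Option E' × (Fin n → V))).symm
    (f := ((graphAutomaton E').schreierGraph n).szegedTerm)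
  have hnone : ∑ w : Fin n → V,
      ((graphAutomaton E').schreierGraph n).szegedTerm ⟨(none, w), trivial⟩ = 0 :=
    Finset.sum_eq_zero fun w _ => szegedTerm_eq_zero_of_isLink_self (u := w)
      (congrArg (s(w, ·)) (act_none w))
  rw [finsum_eq_sum_of_fintype, Fintype.sum_prod_type, Fintype.sum_option] at hfinsum
  rw [Graph.szeged]
  refine (congrArg Nat.cast
    (hfinsum.symm.trans ((congrArg (· + _) hnone).trans (zero_add _)))).trans ?_
  simp only [Nat.cast_sum]
  exact Finset.sum_congr rfl fun f _ => Finset.sum_congr rfl fun w _ =>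
    (hS f).szegedTerm_schreierGraph_eq hV w

end SchreierGraph

section Sums

theorem sum_edgeWords_succ {M : Type*} [AddCommMonoid M] (f : E') (n : ℕ)
    (F : (Fin (n + 1) → V) → M) : ∑ v ∈ edgeWords f (n + 1), F v =
      ∑ w ∈ edgeWords f n, ∑ z ∈ {f.1.1, f.1.2}, F (w ⊳ z) := by
  rw [Finset.sum_comm, ← Finset.sum_product']
  refine (Finset.sum_equiv (Fin.snocEquiv fun _ => V) (fun ⟨z, w⟩ => ?_) fun _ _ => rfl).symm
  exact Finset.mem_product.trans (and_comm.trans snoc_mem_edgeWords.symm)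

theorem sum_compl_edgeWords_succ {M : Type*} [AddCommMonoid M] [Fintype V] (f : E') (n : ℕ)
    (F : (Fin (n + 1) → V) → M) : ∑ v ∈ (edgeWords f (n + 1))ᶜ, F v =
      ∑ w ∈ (edgeWords f n)ᶜ, ∑ z, F (w ⊳ z) +
        ∑ w ∈ edgeWords f n, ∑ z ∈ {f.1.1, f.1.2}ᶜ, F (w ⊳ z) := by
  rw [← Finset.univ_inter (edgeWords f (n + 1))ᶜ, ← Finset.sum_ite_mem, sum_univ_snoc,
    ← Finset.sum_compl_add_sum (edgeWords f n)]
  simp only [Finset.mem_compl, snoc_mem_edgeWords, not_and_or]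
  congr 1 <;> refine Finset.sum_congr rfl fun w hw => ?_
  · simp only [Finset.mem_compl.1 hw, not_false_iff, true_or, if_true]
  · simp only [hw, not_true, false_or, ← Finset.mem_compl, Finset.sum_ite_mem, Finset.univ_inter]

theorem IsSide.sum_edgeWords_ite (hS : IsSide f S) (n : ℕ) (b c : ℚ) :
    ∑ w ∈ edgeWords f n, (if w = (fun _ => f.1.1) then b else c) = b + (2 ^ n - 1) * c := by
  rw [← Finset.add_sum_erase _ _ (const_left_mem_edgeWords f n), if_pos rfl,
    Finset.sum_congr rfl fun w hw => if_neg (Finset.ne_of_mem_erase hw), Finset.sum_const,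
    Finset.card_erase_of_mem (const_left_mem_edgeWords f n), card_edgeWords hS.ne, nsmul_eq_mul,
    Nat.cast_pred (by positivity), Nat.cast_pow, Nat.cast_ofNat]

theorem IsSide.sum_compl_ends_ite [Fintype V] (hS : IsSide f S) (b c : ℚ) :
    ∑ z ∈ {f.1.1, f.1.2}ᶜ, (if z ∈ S then b else c) =
      (S.card - 1) * b + (Sᶜ.card - 1) * c := by
  have hsplit := Finset.sum_add_sum_compl {f.1.1, f.1.2} fun z => if z ∈ S then b else c
  rw [← Finset.sum_add_sum_compl S, Finset.sum_pair hS.ne, if_pos hS.left, if_neg hS.right,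
    Finset.sum_congr (g := fun _ => b) rfl fun z hz => if_pos hz,
    Finset.sum_congr (s₁ := Sᶜ) (g := fun _ => c) rfl fun z hz => if_neg (Finset.mem_compl.1 hz),
    Finset.sum_const, Finset.sum_const, nsmul_eq_mul, nsmul_eq_mul] at hsplit
  linear_combination hsplit

variable [Fintype V]

theorem IsSide.sum_edgeWords_edgeOffcut (hS : IsSide f S)
    (hV : (actionGraph (letterAct : E' → V → V)).Connected) (n : ℕ) (φ : ℕ → ℚ) :
    ∑ v ∈ edgeWords f (n + 1), φ (edgeOffcut f v) =
      2 * (φ (Fintype.card V ^ n * Sᶜ.card) + (2 ^ n - 1) * φ (Fintype.card V ^ n)) := by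
  rw [sum_edgeWords_succ, ← hS.sum_edgeWords_ite, Finset.mul_sum]
  refine Finset.sum_congr rfl fun w hw => ?_
  rw [Finset.sum_congr rfl fun z hz => congrArg φ (hS.edgeOffcut_snoc_of_mem hV hw hz),
    Finset.sum_const, Finset.card_pair hS.ne, mul_ite, mul_one, apply_ite φ, nsmul_eq_mul,
    Nat.cast_ofNat]

theorem sum_compl_edgeWords_one_edgeOffcut (f : E') {φ : ℕ → ℚ} (hφ : φ 0 = 0) :
    ∑ v ∈ (edgeWords f 1)ᶜ, φ (edgeOffcut f v) = 0 := by
  refine Finset.sum_eq_zero fun v hv => ?_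
  cases v using Fin.snocCases with | snoc w z =>
  rw [edgeOffcut_snoc_of_length_zero, hφ]
  intro hz
  exact Finset.mem_compl.1 hv (snoc_mem_edgeWords.2 ⟨Fintype.mem_piFinset.2 finZeroElim, hz⟩)

theorem IsSide.sum_compl_edgeWords_edgeOffcut (hS : IsSide f S)
    (hV : (actionGraph (letterAct : E' → V → V)).Connected) (n : ℕ) (φ : ℕ → ℚ) :
    ∑ v ∈ (edgeWords f (n + 2))ᶜ, φ (edgeOffcut f v) =
      Fintype.card V * ∑ v ∈ (edgeWords f (n + 1))ᶜ, φ (edgeOffcut f v) +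
        2 * ((S.card - 1) * φ (Fintype.card V ^ n * Sᶜ.card) +
          (Sᶜ.card - 1) * φ (Fintype.card V ^ n * S.card) +
          (2 ^ n - 1) * ((S.card - 1 + (Sᶜ.card - 1)) * φ (Fintype.card V ^ n))) := by
  rw [sum_compl_edgeWords_succ, sum_edgeWords_succ, Finset.mul_sum, ← hS.sum_edgeWords_ite,
    Finset.mul_sum]
  congr 1 <;> refine Finset.sum_congr rfl fun w hw => ?_
  · rw [Finset.sum_congr rfl fun z _ => congrArg φ
      (hS.edgeOffcut_snoc_of_notMem hV (Finset.mem_compl.1 hw) z), Finset.sum_const,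
      Finset.card_univ, nsmul_eq_mul]
  · rw [Finset.sum_congr rfl fun z hz => Finset.sum_congr rfl fun a ha => congrArg φ
      (hS.edgeOffcut_snoc_snoc hV hw hz (Finset.mem_compl.1 ha)), Finset.sum_const,
      Finset.card_pair hS.ne, nsmul_eq_mul, Nat.cast_ofNat]
    congr 1
    split_ifs
    · simp only [apply_ite, hS.sum_compl_ends_ite]
    · rw [mul_one, add_mul, ← hS.sum_compl_ends_ite]
      simp only [ite_self]

theorem cast_card_compl_eq_sub (S : Finset V) : (Sᶜ.card : ℚ) = Fintype.card V - S.card := by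
  rw [← S.card_add_card_compl, Nat.cast_add, add_sub_cancel_left]

theorem IsSide.sum_compl_edgeWords_mul_sub (hS : IsSide f S)
    (hV : (actionGraph (letterAct : E' → V → V)).Connected) {k p : ℚ}
    (hk : Fintype.card V = k) (hp : S.card = p) (n : ℕ) (K : ℚ) :
    ∑ v ∈ (edgeWords f (n + 1))ᶜ, (edgeOffcut f v : ℚ) * (K - edgeOffcut f v) =
      2 * k ^ n / k * (K * ((2 * (p * (k - p)) - k) * n + (k - 2) * (2 ^ n - 1 - n)) -
        (k + 2) * (p * (k - p) - (k - 1)) * (k ^ n - 1) / (k - 1) -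
        (k - 2) * (2 ^ n * k ^ n - 1) / (2 * k - 1)) := by
  have hk2 := hk ▸ hS.two_le_card
  induction n with
  | zero => simpa using sum_compl_edgeWords_one_edgeOffcut f (φ := fun s => s * (K - s)) (by simp)
  | succ n ih =>
    rw [hS.sum_compl_edgeWords_edgeOffcut hV n fun s => s * (K - s), ih]
    push_cast
    rw [cast_card_compl_eq_sub, hk, hp, pow_succ k n, pow_succ (2 : ℚ) n]
    have hk0 : k ≠ 0 := by linarith
    have hk1 : k - 1 ≠ 0 := by linarith
    obtain ⟨d, hd⟩ : ∃ d, 2 * k - 1 = d := ⟨_, rfl⟩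
    have hd0 : d ≠ 0 := by linarith
    generalize k ^ n = x
    generalize (2 : ℚ) ^ n = t
    rw [hd]
    field_simp
    rw [← hd]
    ring

theorem IsSide.sum_edgeOffcut_mul_sub (hS : IsSide f S)
    (hV : (actionGraph (letterAct : E' → V → V)).Connected) {k p : ℚ}
    (hk : Fintype.card V = k) (hp : S.card = p) (n : ℕ) :
    ∑ v : Fin (n + 1) → V, (edgeOffcut f v : ℚ) * (k ^ (n + 1) - edgeOffcut f v) =
      2 * (k - 1) * (2 * k ^ 2 - 2 * k - 1) / (k ^ 3 * (2 * k - 1)) *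
          (2 ^ (n + 1) * k ^ (2 * (n + 1))) -
        4 * (k - 1) / k ^ 2 * ((n + 1) * k ^ (2 * (n + 1))) +
        4 * (k + 1) / k ^ 3 * k ^ (2 * (n + 1)) -
        4 * (k + 1) / (k * (2 * k - 1)) * k ^ (n + 1) +
        (4 / k ^ 2 * ((n + 1) * k ^ (2 * (n + 1))) -
          2 * (k ^ 2 + 2) / (k ^ 3 * (k - 1)) * k ^ (2 * (n + 1)) +
          2 * (k + 2) / (k ^ 2 * (k - 1)) * k ^ (n + 1)) * (p * (k - p)) := by
  have hk2 := hk ▸ hS.two_le_card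
  rw [← Finset.sum_add_sum_compl (edgeWords f (n + 1)), hS.sum_compl_edgeWords_mul_sub hV hk hp,
    hS.sum_edgeWords_edgeOffcut hV n fun s => s * (k ^ (n + 1) - s)]
  push_cast
  rw [cast_card_compl_eq_sub, hk, hp, pow_mul', pow_succ k n, pow_succ (2 : ℚ) n]
  have hk0 : k ≠ 0 := by linarith
  have hk1 : k - 1 ≠ 0 := by linarith
  obtain ⟨d, hd⟩ : ∃ d, 2 * k - 1 = d := ⟨_, rfl⟩
  have hd0 : d ≠ 0 := by linarith
  generalize k ^ n = x
  generalize (2 : ℚ) ^ n = t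
  rw [hd]
  field_simp
  rw [← hd]
  ring

end Sums

end Words

theorem mainTheorem2 {V : Type*} [Fintype V] [DecidableEq V] (G : SimpleGraph V) (hG : G.IsTree)
    (E' : Set (V × V)) (hE' : G.IsOrientation E')
    (k : ℕ) (hk : Fintype.card V = k) (hk2 : 2 ≤ k) (n : ℕ) (hn : 1 ≤ n) :
    ((((graphAutomaton E').schreierGraph n).szeged : ℕ) : ℚ) =
      2 * ((k : ℚ) - 1) ^ 2 * (2 * (k : ℚ) ^ 2 - 2 * k - 1) / ((k : ℚ) ^ 3 * (2 * k - 1))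
          * (2 ^ n * (k : ℚ) ^ (2 * n))
        - 4 * ((k : ℚ) - 1) ^ 2 / (k : ℚ) ^ 2 * (n * (k : ℚ) ^ (2 * n))
        + 4 * ((k : ℚ) + 1) * ((k : ℚ) - 1) / (k : ℚ) ^ 3 * (k : ℚ) ^ (2 * n)
        - 4 * ((k : ℚ) + 1) * ((k : ℚ) - 1) / ((k : ℚ) * (2 * k - 1)) * (k : ℚ) ^ n
        + (4 / (k : ℚ) ^ 2 * (n * (k : ℚ) ^ (2 * n))
            - 2 * ((k : ℚ) ^ 2 + 2) / ((k : ℚ) ^ 3 * ((k : ℚ) - 1)) * (k : ℚ) ^ (2 * n)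
            + 2 * ((k : ℚ) + 2) / ((k : ℚ) ^ 2 * ((k : ℚ) - 1)) * (k : ℚ) ^ n)
          * ((Graph.ofSimpleGraph G).szeged : ℚ) := by
  classical
  have := Fintype.ofFinite E'
  obtain ⟨n, rfl⟩ : ∃ m, n = m + 1 := ⟨n - 1, by omega⟩
  choose S hS using exists_isSide hG hE'
  have hV := (actionGraph_letterAct hE').symm ▸ hG.connected
  have hk' : (Fintype.card V : ℚ) = k := congrArg Nat.cast hk
  have hcard : (Fintype.card E' : ℚ) = k - 1 := by
    rw [← hk', ← card_add_one_of_isOrientation hG hE', Nat.cast_succ, add_sub_cancel_right]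
  have hszeged : ((Graph.ofSimpleGraph G).szeged : ℚ) =
      ∑ f, ((S f).card : ℚ) * (k - (S f).card) := by
    simp only [szeged_ofSimpleGraph_eq_sum hG.connected hE' hS, Nat.cast_sum, Nat.cast_mul,
      Nat.cast_sub (Finset.card_le_univ _), hk']
  have hterm (f : E') := (hS f).sum_edgeOffcut_mul_sub hV hk' rfl n
  rw [szeged_schreierGraph_eq_sum hS hV, hszeged]
  simp only [hk', hterm, Finset.sum_add_distrib, ← Finset.mul_sum, Finset.sum_const,
    Finset.card_univ, nsmul_eq_mul, hcard]
  push_cast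
  ring
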